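/- Let $L^2[0,1]$ be the space of real-valued square-integrable functions on $[0,1]$ (functions equal almost everywhere being identified). For $\nu\in L^2[0,1]$ let $V_\nu(f)=\int_0^1\nu(t)e^{-2\pi i f t}\,dt$ $(f\in\mathbb R)$ and let $B(\nu)=\int_{-\infty}^{\infty}|V_\nu(f)|^2f^2\,df\in[0,\infty]$ be the local bias of $\nu$. Call a sequence $(v_k)_{k\ge1}$ in $L^2[0,1]$ a minimum bias system if for every $k\ge1$: (i) $\int_0^1 v_k(t)^2\,dt=1$, and (ii) $v_k$ is orthogonal to $v_1,\dots,v_{k-1}$, and $B(v_k)\le B(w)$ for every $w\in L^2[0,1]$ with $\int_0^1 w(t)^2\,dt=1$ that is orthogonal to $v_1,\dots,v_{k-1}$. Then the functions $v_k(t)=\sqrt2\,\sin(\pi k t)$, $k=1,2,\dots$, form a minimum bias system, and it is the only one up to signs: a sequence $(v_k)_{k\ge1}$ in $L^2[0,1]$ is a minimum bias system if and only if for every $k$ either $v_k=\sqrt2\sin(\pi k\,\cdot)$ or $v_k=-\sqrt2\sin(\pi k\,\cdot)$. For every minimum bias system the $k$-th minimum value is $B(v_k)=k^2/4$. -/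

import Mathlib

open MeasureTheory

noncomputable section

/-- Real-valued tapers: the real Hilbert space `L²[0,1]` (Lebesgue measure). -/
abbrev TaperSpace : Type :=
  Lp ℝ 2 ((volume : Measure ℝ).restrict (Set.Icc (0 : ℝ) 1))

/-- The spectral window `V(f) = ∫₀¹ ν(t) e^{-2πi f t} dt` of a taper `ν ∈ L²[0,1]`. -/
def spectralWindow (ν : TaperSpace) (f : ℝ) : ℂ :=
  ∫ t in Set.Icc (0 : ℝ) 1,
    ((ν t : ℝ) : ℂ) * Complex.exp (-(2 * Real.pi * Complex.I * f * t))

/-- The local bias `∫_ℝ |V(f)|² f² df`, as an element of `[0, ∞]`; it is `∞` exactly when the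
nonnegative function `|V(f)|² f²` is not integrable over the real line. -/
def localBias (ν : TaperSpace) : ENNReal :=
  ∫⁻ f : ℝ, ENNReal.ofReal (‖spectralWindow ν f‖ ^ 2 * f ^ 2)

theorem memLp_sine (k : ℕ+) :
    MemLp (fun t : ℝ => √2 * Real.sin (Real.pi * ((k : ℕ) : ℝ) * t)) 2
      ((volume : Measure ℝ).restrict (Set.Icc (0 : ℝ) 1)) := by
  refine MemLp.of_bound (by fun_prop) (√2) (Filter.Eventually.of_forall fun t => ?_)
  rw [norm_mul, Real.norm_of_nonneg (Real.sqrt_nonneg 2), Real.norm_eq_abs]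
  exact mul_le_of_le_one_right (Real.sqrt_nonneg 2) (Real.abs_sin_le_one _)

/-- The taper `√2 sin(π k t)`, `k = 1, 2, …`, as an element of `L²[0,1]`. -/
def sineTaper (k : ℕ+) : TaperSpace := (memLp_sine k).toLp _

/-- The competitors for the `k`-th taper, given `v₁, …, v_{k-1}`: the elements of `L²[0,1]` of
unit norm that are orthogonal to `v₁, …, v_{k-1}`. -/
def admissibleTapers (v : ℕ+ → TaperSpace) (k : ℕ+) : Set TaperSpace :=
  {w | ‖w‖ = 1 ∧ ∀ j : ℕ+, j < k → inner ℝ (v j) w = 0}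

/-- A minimum bias system: for every `k`, `v_k` has unit norm, is orthogonal to `v₁, …, v_{k-1}`,
and has the least local bias among all such elements of `L²[0,1]`. -/
def IsMinimumBiasSystem (v : ℕ+ → TaperSpace) : Prop :=
  ∀ k : ℕ+, v k ∈ admissibleTapers v k ∧ IsMinOn localBias (admissibleTapers v k) (v k)

end

open scoped FourierTransform ContDiff

/-! Formally, `4π² B(ν)` is the squared norm of the derivative of the extension of `ν` by zero to
`ℝ`. In the sine basis, with `c_k = ⟨√2 sin(πk·), ν⟩`, it should therefore be `π² ∑ k² c_k²`.

Only two facts are needed. The lower bound `∑ (k²/4) c_k² ≤ B(ν)` over finite sets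
(`ofReal_sum_sq_inner_sineTaper_le_localBias`) uses difference quotients, so no weak derivative has
to exist. By Plancherel their norms are bounded by `4π² B(ν)`. Bessel's inequality against cosines
on `[-h,1]` bounds their coefficients, and these tend to `πk c_k` as `h → 0+`. The exact value
`k²/4` at the sines (`localBias_sineTaper`) is an integration by parts.

If `‖w‖ = 1` and `c_j = 0` for `j < k`, then `∑ c_j² = 1` gives `B(w) ≥ k²/4`, with equality only if
`c_m = 0` for all `m > k`. Induction on `k` finishes, since signs do not affect orthogonality. -/

/-! ### Plancherel's theorem on `L¹ ∩ L²`. -/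

theorem fourier_toLp_ae_eq {g : ℝ → ℂ} (h1 : Integrable g) (h2 : MemLp g 2) :
    (𝓕 (h2.toLp g) : Lp ℂ 2 (volume : Measure ℝ)) =ᵐ[volume] 𝓕 g := by
  have hcont : Continuous (𝓕 g) :=
    VectorFourier.fourierIntegral_continuous Real.continuous_fourierChar
      (by exact continuous_inner) h1
  -- The `L²` transform and the integral transform agree against test functions: in both, the
  -- transform can be moved onto the test function.
  refine ae_eq_of_integral_contDiff_smul_eq
    ((Lp.memLp _).locallyIntegrable (by norm_num)) hcont.locallyIntegrable fun φ hφ hφc => ?_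
  have hc : HasCompactSupport (Complex.ofRealCLM ∘ φ) := hφc.comp_left rfl
  have hs : ContDiff ℝ ∞ (Complex.ofRealCLM ∘ φ) := by fun_prop
  set Φ := hc.toSchwartzMap hs with hΦ
  have hΦφ : ∀ x, Φ x = (φ x : ℂ) := fun x => rfl
  have key := congrArg (fun T => T Φ) (Lp.fourier_toTemperedDistribution_eq (h2.toLp g))
  simp only [TemperedDistribution.fourier_apply, Lp.toTemperedDistribution_apply, hΦφ] at key
  have hflip := VectorFourier.integral_fourierIntegral_smul_eq_flip (μ := volume) (ν := volume)
    (L := innerₗ ℝ) Real.continuous_fourierChar (by exact continuous_inner) Φ.integrable h1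
  calc ∫ x, φ x • (𝓕 (h2.toLp g) : Lp ℂ 2 (volume : Measure ℝ)) x
      = ∫ x, (𝓕 Φ) x • (h2.toLp g) x := by rw [key]; rfl
    _ = ∫ x, (𝓕 Φ) x • g x := by
        refine integral_congr_ae ?_
        filter_upwards [h2.coeFn_toLp] with x hx
        rw [hx]
    _ = ∫ x, Φ x • 𝓕 g x := by
        rw [flip_innerₗ] at hflip
        exact hflip
    _ = ∫ x, φ x • 𝓕 g x := rfl

/-- **Plancherel's theorem** for functions that are integrable and square integrable. -/
theorem lintegral_enorm_sq_fourier {g : ℝ → ℂ} (h1 : Integrable g) (h2 : MemLp g 2) :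
    ∫⁻ f, ‖𝓕 g f‖ₑ ^ 2 = ∫⁻ t, ‖g t‖ₑ ^ 2 := by
  have hsq : ∀ F : Lp ℂ 2 (volume : Measure ℝ), ∫⁻ x, ‖F x‖ₑ ^ 2 = ‖F‖ₑ ^ 2 := fun F => by
    rw [Lp.enorm_def, eLpNorm_eq_lintegral_rpow_enorm_toReal (by norm_num) (by norm_num)]
    rw [← ENNReal.rpow_natCast, ← ENNReal.rpow_mul]
    simp
  have hF := hsq (𝓕 (h2.toLp g))
  have hg := hsq (h2.toLp g)
  have hn : ‖(𝓕 (h2.toLp g) : Lp ℂ 2 (volume : Measure ℝ))‖ₑ = ‖h2.toLp g‖ₑ := by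
    rw [← ofReal_norm, ← ofReal_norm, Lp.norm_fourier_eq]
  rw [hn, ← hg] at hF
  have e1 : ∫⁻ f, ‖𝓕 g f‖ₑ ^ 2 = _ := lintegral_congr_ae
    ((fourier_toLp_ae_eq h1 h2).mono fun x hx => by
      show _ = ‖(𝓕 (h2.toLp g) : Lp ℂ 2 (volume : Measure ℝ)) x‖ₑ ^ 2
      rw [hx])
  have e2 : ∫⁻ t, ‖h2.toLp g t‖ₑ ^ 2 = ∫⁻ t, ‖g t‖ₑ ^ 2 := lintegral_congr_ae
    (h2.coeFn_toLp.mono fun x hx => by simp only [hx])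
  rw [e1, hF, e2]

/-! ### Orthonormality and completeness of the sines. -/

theorem integral_cos_pi_mul_int {n : ℤ} (hn : n ≠ 0) :
    ∫ t in (0 : ℝ)..1, Real.cos (Real.pi * n * t) = 0 := by
  have h : Real.pi * n ≠ 0 := mul_ne_zero Real.pi_ne_zero (by exact_mod_cast hn)
  rw [intervalIntegral.integral_comp_mul_left (fun x => Real.cos x) h, integral_cos]
  simp [mul_comm Real.pi, Real.sin_int_mul_pi]

theorem integral_two_mul_sin_mul_sin (j k : ℕ+) :
    ∫ t in (0 : ℝ)..1, 2 * (Real.sin (Real.pi * (j : ℕ) * t) * Real.sin (Real.pi * (k : ℕ) * t))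
      = if j = k then 1 else 0 := by
  have h : ∀ t : ℝ, 2 * (Real.sin (Real.pi * (j : ℕ) * t) * Real.sin (Real.pi * (k : ℕ) * t))
      = Real.cos (Real.pi * ((j : ℤ) - (k : ℤ) : ℤ) * t)
        - Real.cos (Real.pi * ((j : ℤ) + (k : ℤ) : ℤ) * t) := fun t => by
    push_cast
    rw [mul_sub, mul_add, sub_mul, add_mul, Real.cos_sub, Real.cos_add]
    ring
  simp_rw [h]
  rw [intervalIntegral.integral_sub (by apply Continuous.intervalIntegrable; fun_prop)
    (by apply Continuous.intervalIntegrable; fun_prop),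
    integral_cos_pi_mul_int (n := (j : ℤ) + (k : ℤ)) (by have := j.pos; have := k.pos; omega)]
  split_ifs with hjk
  · simp [hjk]
  · rw [integral_cos_pi_mul_int, sub_zero]
    intro h0
    exact hjk (PNat.eq (by omega))

theorem integral_two_mul_cos_mul_cos (j k : ℕ+) :
    ∫ t in (0 : ℝ)..1, 2 * (Real.cos (Real.pi * (j : ℕ) * t) * Real.cos (Real.pi * (k : ℕ) * t))
      = if j = k then 1 else 0 := by
  have h : ∀ t : ℝ, 2 * (Real.cos (Real.pi * (j : ℕ) * t) * Real.cos (Real.pi * (k : ℕ) * t))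
      = Real.cos (Real.pi * ((j : ℤ) - (k : ℤ) : ℤ) * t)
        + Real.cos (Real.pi * ((j : ℤ) + (k : ℤ) : ℤ) * t) := fun t => by
    push_cast
    rw [mul_sub, mul_add, sub_mul, add_mul, Real.cos_sub, Real.cos_add]
    ring
  simp_rw [h]
  rw [intervalIntegral.integral_add (by apply Continuous.intervalIntegrable; fun_prop)
    (by apply Continuous.intervalIntegrable; fun_prop),
    integral_cos_pi_mul_int (n := (j : ℤ) + (k : ℤ)) (by have := j.pos; have := k.pos; omega)]
  split_ifs with hjk
  · simp [hjk]
  · rw [integral_cos_pi_mul_int, add_zero]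
    intro h0
    exact hjk (PNat.eq (by omega))

theorem inner_sineTaper (k : ℕ+) (ν : TaperSpace) :
    inner ℝ (sineTaper k) ν
      = ∫ t in Set.Icc (0 : ℝ) 1, ν t * (√2 * Real.sin (Real.pi * ((k : ℕ) : ℝ) * t)) := by
  rw [L2.inner_def]
  refine integral_congr_ae ?_
  filter_upwards [(memLp_sine k).coeFn_toLp] with t ht
  rw [sineTaper, ht]
  simp

theorem orthonormal_sineTaper : Orthonormal ℝ sineTaper := by
  rw [orthonormal_iff_ite]
  intro j k
  rw [inner_sineTaper, ← integral_two_mul_sin_mul_sin j k, intervalIntegral.integral_of_le zero_le_one,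
    ← integral_Icc_eq_integral_Ioc]
  refine integral_congr_ae ?_
  filter_upwards [(memLp_sine k).coeFn_toLp] with t ht
  rw [sineTaper, ht]
  have := Real.mul_self_sqrt (zero_le_two (α := ℝ))
  linear_combination (Real.sin (Real.pi * (j : ℕ) * t) * Real.sin (Real.pi * (k : ℕ) * t)) * this

/-- The extension of a taper by zero to the whole real line. -/
noncomputable def zeroExtension (ν : TaperSpace) : ℝ → ℝ := (Set.Icc (0 : ℝ) 1).indicator ν

theorem memLp_zeroExtension (ν : TaperSpace) : MemLp (zeroExtension ν) 2 :=
  (memLp_indicator_iff_restrict measurableSet_Icc).2 (Lp.memLp ν)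

theorem integrable_zeroExtension (ν : TaperSpace) : Integrable (zeroExtension ν) :=
  (integrable_indicator_iff measurableSet_Icc).2 ((Lp.memLp ν).integrable (by norm_num))

theorem zeroExtension_of_notMem (ν : TaperSpace) {t : ℝ} (ht : t ∉ Set.Icc (0 : ℝ) 1) :
    zeroExtension ν t = 0 := Set.indicator_of_notMem ht _

theorem integral_zeroExtension_mul (ν : TaperSpace) (φ : ℝ → ℝ) :
    ∫ t, zeroExtension ν t * φ t = ∫ t in Set.Icc (0 : ℝ) 1, ν t * φ t := by
  rw [← integral_indicator measurableSet_Icc]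
  congr 1
  ext t
  by_cases ht : t ∈ Set.Icc (0 : ℝ) 1 <;> simp [zeroExtension, ht]

theorem inner_sineTaper_eq_integral_zeroExtension (k : ℕ+) (ν : TaperSpace) :
    inner ℝ (sineTaper k) ν
      = ∫ t, zeroExtension ν t * (√2 * Real.sin (Real.pi * ((k : ℕ) : ℝ) * t)) := by
  rw [inner_sineTaper, integral_zeroExtension_mul]

theorem integral_zeroExtension_mul_sin_eq_zero {ν : TaperSpace}
    (h : ∀ k : ℕ+, inner ℝ (sineTaper k) ν = 0) (n : ℤ) :
    ∫ t, zeroExtension ν t * Real.sin (Real.pi * n * t) = 0 := by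
  have hpos : ∀ k : ℕ+, ∫ t, zeroExtension ν t * Real.sin (Real.pi * ((k : ℕ) : ℝ) * t) = 0 := by
    intro k
    have hk := h k
    rw [inner_sineTaper_eq_integral_zeroExtension] at hk
    simp_rw [mul_left_comm _ (√2)] at hk
    rw [integral_const_mul] at hk
    exact (mul_eq_zero.1 hk).resolve_left (by positivity)
  rcases lt_trichotomy n 0 with hn | rfl | hn
  · obtain ⟨m, rfl⟩ : ∃ m : ℕ, n = -m := ⟨n.natAbs, by omega⟩
    have := hpos ⟨m, by omega⟩
    simp only [PNat.mk_coe] at this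
    push_cast
    simp only [mul_neg, neg_mul, Real.sin_neg]
    rw [integral_neg, this, neg_zero]
  · simp
  · obtain ⟨m, rfl⟩ : ∃ m : ℕ, n = m := ⟨n.natAbs, by omega⟩
    exact hpos ⟨m, by omega⟩

/-- The odd reflection of `ν` to `[-1,1]` has only sine coefficients, all zero by hypothesis, so
Parseval for the complex exponentials makes it vanish. -/
theorem eq_zero_of_inner_sineTaper_eq_zero {ν : TaperSpace}
    (h : ∀ k : ℕ+, inner ℝ (sineTaper k) ν = 0) : ν = 0 := by
  set u := zeroExtension ν with hu
  set F : ℝ → ℂ := fun t => ((u t - u (-t) : ℝ) : ℂ) with hF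
  have huneg : MemLp (fun t => u (-t)) 2 :=
    (memLp_zeroExtension ν).comp_measurePreserving (Measure.measurePreserving_neg volume)
  have hF2 : MemLp F 2 := ((memLp_zeroExtension ν).sub huneg).ofReal
  have hF1 : Integrable F := ((integrable_zeroExtension ν).sub
    (integrable_zeroExtension ν).comp_neg).ofReal
  have hcoeff : ∀ n : ℤ, fourierCoeffOn (by norm_num : (-1 : ℝ) < 1) F n = 0 := by
    intro n
    rw [fourierCoeffOn_eq_integral]
    have hsupp : ∀ t, t ∉ Set.Icc (-1 : ℝ) 1 → F t = 0 := fun t ht => by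
      have h1 : t ∉ Set.Icc (0 : ℝ) 1 := fun h' => ht ⟨by linarith [h'.1], h'.2⟩
      have h2 : -t ∉ Set.Icc (0 : ℝ) 1 := fun h' => ht ⟨by linarith [h'.2], by linarith [h'.1]⟩
      simp [hF, hu, zeroExtension_of_notMem ν h1, zeroExtension_of_notMem ν h2]
    have hexp : ∀ t : ℝ, fourier (-n) (t : AddCircle ((1 : ℝ) - -1))
        = Complex.exp (-(Real.pi * n * t : ℝ) * Complex.I) := fun t => by
      rw [fourier_coe_apply]
      congr 1
      push_cast
      ring
    simp_rw [hexp]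
    rw [intervalIntegral.integral_of_le (by norm_num), ← integral_Icc_eq_integral_Ioc,
      setIntegral_eq_integral_of_forall_compl_eq_zero (fun t ht => by rw [hsupp t ht, smul_zero])]
    set e : ℝ → ℂ := fun t => Complex.exp (-(Real.pi * n * t : ℝ) * Complex.I) with he
    have heint : ∀ {f : ℝ → ℂ}, Integrable f → Integrable (fun t => e t * f t) := fun {f} hf =>
      hf.bdd_mul (c := 1) (by fun_prop) (Filter.Eventually.of_forall fun t => by
        rw [show e t = Complex.exp ((-(Real.pi * n * t) : ℝ) * Complex.I) by simp [he],
          Complex.norm_exp_ofReal_mul_I])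
    have hui : Integrable (fun t => (u t : ℂ)) := (integrable_zeroExtension ν).ofReal
    -- Substituting `-t` for `t` in the reflected half leaves `e(t) - e(-t) = -2i sin(πnt)` against
    -- `u`.
    have hdec : ∫ t, e t • F t = ∫ t, (-2 * Complex.I) * ((u t * Real.sin (Real.pi * n * t) : ℝ) : ℂ) := by
      have h1 : ∫ t, e t • F t = (∫ t, e t * (u t : ℂ)) - ∫ t, e t * (u (-t) : ℂ) := by
        rw [← integral_sub (heint hui) (heint hui.comp_neg)]
        congr 1; ext t; simp [hF, mul_sub]
      have h2 : ∫ t, e t * (u (-t) : ℂ) = ∫ t, e (-t) * (u t : ℂ) := by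
        rw [← integral_neg_eq_self]
        simp
      have h3 : Integrable (fun t => e (-t) * (u t : ℂ)) := by
        simpa using (heint hui.comp_neg).comp_neg
      rw [h1, h2, ← integral_sub (heint hui) h3]
      congr 1; ext t
      simp only [he]
      have : (-(Real.pi * n * (-t) : ℝ) : ℂ) = ((Real.pi * n * t : ℝ) : ℂ) := by push_cast; ring
      rw [this, ← Complex.ofReal_neg, Complex.exp_mul_I, Complex.exp_mul_I]
      push_cast
      rw [Complex.cos_neg, Complex.sin_neg]
      ring
    rw [hdec, integral_const_mul, integral_complex_ofReal, integral_zeroExtension_mul_sin_eq_zero h n]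
    simp
  have hsum := hasSum_sq_fourierCoeffOn (by norm_num : (-1 : ℝ) < 1)
    (hF2.restrict (Set.Ioc (-1) 1))
  simp only [hcoeff, norm_zero, ne_eq, OfNat.ofNat_ne_zero, not_false_eq_true, zero_pow] at hsum
  have hz := hsum.unique hasSum_zero
  rw [smul_eq_mul, mul_eq_zero] at hz
  have hz := hz.resolve_left (by norm_num)
  rw [intervalIntegral.integral_of_le (by norm_num), setIntegral_eq_zero_iff_of_nonneg_ae
    (Filter.Eventually.of_forall fun t => by positivity)
    ((memLp_two_iff_integrable_sq_norm hF2.1.restrict).1 (hF2.restrict _))] at hz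
  have hz' := ae_restrict_of_ae_restrict_of_subset
    (Set.Ioc_subset_Ioc_left (by norm_num : (-1 : ℝ) ≤ 0)) hz
  -- The point `0` is left out so that `-t` lies outside `[0,1]` and the reflected term vanishes.
  have hν : ∀ᵐ t ∂(volume.restrict (Set.Ioc (0 : ℝ) 1)), (ν : ℝ → ℝ) t = 0 := by
    filter_upwards [hz', ae_restrict_mem measurableSet_Ioc] with t ht htm
    have h1 : t ∈ Set.Icc (0 : ℝ) 1 := ⟨htm.1.le, htm.2⟩
    have h2 : -t ∉ Set.Icc (0 : ℝ) 1 := fun h' => by linarith [h'.1, htm.1]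
    have hut : u t = ν t := Set.indicator_of_mem h1 _
    simpa [hF, hut, show u (-t) = 0 from zeroExtension_of_notMem ν h2] using ht
  rw [restrict_Ioc_eq_restrict_Icc] at hν
  exact (Lp.eq_zero_iff_ae_eq_zero).2 hν

/-- The Hilbert basis of `L²[0,1]` formed by the sine tapers. -/
noncomputable def sineBasis : HilbertBasis ℕ+ ℝ TaperSpace :=
  HilbertBasis.mkOfOrthogonalEqBot orthonormal_sineTaper <| by
    rw [Submodule.eq_bot_iff]
    intro ν hν
    refine eq_zero_of_inner_sineTaper_eq_zero fun k => ?_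
    exact (Submodule.mem_orthogonal _ _).1 hν _ (Submodule.subset_span ⟨k, rfl⟩)

theorem sineBasis_apply (k : ℕ+) : sineBasis k = sineTaper k := by
  simp [sineBasis]

theorem hasSum_sq_inner_sineTaper (ν : TaperSpace) :
    HasSum (fun k => (inner ℝ (sineTaper k) ν) ^ 2) (‖ν‖ ^ 2) := by
  have := sineBasis.hasSum_inner_mul_inner ν ν
  simp only [sineBasis_apply, real_inner_self_eq_norm_sq] at this
  have e : (fun k => inner ℝ (sineTaper k) ν ^ 2)
      = fun k => inner ℝ ν (sineTaper k) * inner ℝ (sineTaper k) ν := by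
    ext k
    rw [real_inner_comm (sineTaper k) ν, sq]
  rw [e]
  exact this

/-! ### Difference quotients on the Fourier side. -/

theorem spectralWindow_eq_fourier (ν : TaperSpace) :
    spectralWindow ν = 𝓕 (fun t => (zeroExtension ν t : ℂ)) := by
  ext f
  rw [spectralWindow, Real.fourier_eq', ← integral_indicator measurableSet_Icc]
  congr 1
  ext t
  by_cases ht : t ∈ Set.Icc (0 : ℝ) 1
  · simp only [ht, Set.indicator_of_mem, zeroExtension, smul_eq_mul]
    rw [mul_comm]
    congr 2
    simp
    ring
  · simp [zeroExtension, ht]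

/-- The forward difference quotient of the extension by zero of a taper. -/
noncomputable def differenceQuotient (ν : TaperSpace) (h t : ℝ) : ℝ :=
  h⁻¹ * (zeroExtension ν (t + h) - zeroExtension ν t)

theorem memLp_differenceQuotient (ν : TaperSpace) (h : ℝ) :
    MemLp (differenceQuotient ν h) 2 :=
  (((memLp_zeroExtension ν).comp_measurePreserving
    (measurePreserving_add_right volume h)).sub (memLp_zeroExtension ν)).const_mul _

theorem integrable_differenceQuotient (ν : TaperSpace) (h : ℝ) :
    Integrable (differenceQuotient ν h) :=
  (((integrable_zeroExtension ν).comp_add_right h).sub (integrable_zeroExtension ν)).const_mul _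

theorem fourier_differenceQuotient (ν : TaperSpace) (h f : ℝ) :
    𝓕 (fun t => (differenceQuotient ν h t : ℂ)) f
      = (h : ℂ)⁻¹ * ((Complex.exp (Complex.I * (2 * Real.pi * (h * f) : ℝ)) - 1)
        * spectralWindow ν f) := by
  have hshift : 𝓕 (fun t => (zeroExtension ν (t + h) : ℂ)) f
      = Complex.exp (Complex.I * (2 * Real.pi * (h * f) : ℝ)) * spectralWindow ν f := by
    rw [spectralWindow_eq_fourier]
    have := congrFun (VectorFourier.fourierIntegral_comp_add_right Real.fourierChar volume
      (innerₗ ℝ) (fun t => (zeroExtension ν t : ℂ)) h) f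
    refine (this.trans ?_)
    rw [Circle.smul_def, Real.fourierChar_apply, smul_eq_mul]
    congr 2
    simp
    ring
  have hi : Integrable (fun t => (zeroExtension ν t : ℂ)) := (integrable_zeroExtension ν).ofReal
  rw [sub_mul, one_mul, ← hshift, spectralWindow_eq_fourier, Real.fourier_eq, Real.fourier_eq,
    Real.fourier_eq, ← integral_sub
    ((Real.fourierIntegral_convergent_iff f).2 (hi.comp_add_right h))
    ((Real.fourierIntegral_convergent_iff f).2 hi), ← integral_const_mul]
  congr 1
  ext t
  simp only [differenceQuotient, Circle.smul_def, smul_eq_mul]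
  push_cast
  ring

/-- After Plancherel, `|exp(ix) - 1| ≤ |x|` at `x = 2πhf` cancels the factor `h⁻¹`, so the bound is
uniform in `h`. -/
theorem lintegral_sq_differenceQuotient_le (ν : TaperSpace) {h : ℝ} (hh : 0 < h) :
    ∫⁻ t, ‖differenceQuotient ν h t‖ₑ ^ 2 ≤ ENNReal.ofReal (4 * Real.pi ^ 2) * localBias ν := by
  have hP := lintegral_enorm_sq_fourier (g := fun t => (differenceQuotient ν h t : ℂ))
    (integrable_differenceQuotient ν h).ofReal (memLp_differenceQuotient ν h).ofReal
  have e : ∀ t, ‖(differenceQuotient ν h t : ℂ)‖ₑ = ‖differenceQuotient ν h t‖ₑ := fun t => by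
    rw [← ofReal_norm, ← ofReal_norm, Complex.norm_real]
  simp_rw [e] at hP
  rw [← hP, localBias, ← lintegral_const_mul' _ _ ENNReal.ofReal_ne_top]
  refine lintegral_mono fun f => ?_
  rw [← ENNReal.ofReal_mul (by positivity), ← ofReal_norm, ← ENNReal.ofReal_pow (norm_nonneg _)]
  refine ENNReal.ofReal_le_ofReal ?_
  rw [fourier_differenceQuotient, norm_mul, norm_mul, norm_inv, Complex.norm_real,
    Real.norm_of_nonneg hh.le]
  have h1 := Real.norm_exp_I_mul_ofReal_sub_one_le (x := 2 * Real.pi * (h * f))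
  have h2 : h⁻¹ * (‖Complex.exp (Complex.I * (2 * Real.pi * (h * f) : ℝ)) - 1‖
      * ‖spectralWindow ν f‖) ≤ 2 * Real.pi * |f| * ‖spectralWindow ν f‖ := by
    rw [inv_mul_le_iff₀ hh]
    refine (mul_le_mul_of_nonneg_right h1 (norm_nonneg _)).trans (le_of_eq ?_)
    rw [Real.norm_eq_abs, abs_mul, abs_mul h, abs_of_pos hh, abs_of_pos Real.two_pi_pos]
    ring
  refine (pow_le_pow_left₀ (by positivity) h2 2).trans (le_of_eq ?_)
  rw [mul_pow, mul_pow, sq_abs]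
  ring

/-! ### Bessel's inequality and the cosine coefficients. -/

theorem sum_sq_integral_mul_le {α ι : Type*} [MeasurableSpace α] {μ : Measure α} [DecidableEq ι]
    {ψ : ι → α → ℝ} (hψ : ∀ i, MemLp (ψ i) 2 μ)
    (ho : ∀ i j, ∫ x, ψ i x * ψ j x ∂μ = if i = j then 1 else 0)
    {g : α → ℝ} (hg : MemLp g 2 μ) (s : Finset ι) :
    ∑ i ∈ s, (∫ x, g x * ψ i x ∂μ) ^ 2 ≤ ∫ x, g x ^ 2 ∂μ := by
  have hinner : ∀ {a b : α → ℝ} (ha : MemLp a 2 μ) (hb : MemLp b 2 μ),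
      inner ℝ (ha.toLp a) (hb.toLp b) = ∫ x, b x * a x ∂μ := fun ha hb => by
    rw [L2.inner_def]
    refine integral_congr_ae ?_
    filter_upwards [ha.coeFn_toLp, hb.coeFn_toLp] with x h1 h2
    rw [h1, h2]
    simp
  have hON : Orthonormal ℝ (fun i => (hψ i).toLp (ψ i)) := by
    rw [orthonormal_iff_ite]
    intro i j
    rw [hinner, ho j i]
    simp only [eq_comm]
  have := hON.sum_inner_products_le (hg.toLp g) (s := s)
  rw [← real_inner_self_eq_norm_sq, hinner] at this
  simp only [hinner, Real.norm_eq_abs, sq_abs] at this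
  simpa only [sq (g _)] using this

/-- The orthonormal cosine functions on the interval `[-h, 1]`. -/
noncomputable def shiftedCosine (h : ℝ) (k : ℕ+) (t : ℝ) : ℝ :=
  √(2 / (1 + h)) * Real.cos (Real.pi * (k : ℕ) / (1 + h) * (t + h))

theorem continuous_shiftedCosine (h : ℝ) (k : ℕ+) : Continuous (shiftedCosine h k) := by
  unfold shiftedCosine
  fun_prop

theorem abs_shiftedCosine_le (h : ℝ) (k : ℕ+) (t : ℝ) : |shiftedCosine h k t| ≤ √(2 / (1 + h)) := by
  rw [shiftedCosine, abs_mul, abs_of_nonneg (Real.sqrt_nonneg _)]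
  exact mul_le_of_le_one_right (Real.sqrt_nonneg _) (Real.abs_cos_le_one _)

theorem integral_shiftedCosine_mul {h : ℝ} (hh : 0 < h) (j k : ℕ+) :
    ∫ t in Set.Ioc (-h) 1, shiftedCosine h j t * shiftedCosine h k t
      = if j = k then 1 else 0 := by
  have hL : (1 + h) ≠ 0 := by positivity
  rw [← integral_two_mul_cos_mul_cos j k, ← intervalIntegral.integral_of_le (by linarith)]
  have := intervalIntegral.integral_comp_div_add (a := -h) (b := 1)
    (fun x => 2 * (Real.cos (Real.pi * (j : ℕ) * x) * Real.cos (Real.pi * (k : ℕ) * x))) hL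
    (h / (1 + h))
  rw [show -h / (1 + h) + h / (1 + h) = 0 by ring, show 1 / (1 + h) + h / (1 + h) = 1 by field_simp,
    smul_eq_mul] at this
  rw [← mul_right_inj' hL, ← this, ← intervalIntegral.integral_const_mul]
  congr 1
  ext t
  have hs : √(2 / (1 + h)) * √(2 / (1 + h)) = 2 / (1 + h) := Real.mul_self_sqrt (by positivity)
  simp only [shiftedCosine]
  rw [show Real.pi * (j : ℕ) * (t / (1 + h) + h / (1 + h))
      = Real.pi * (j : ℕ) / (1 + h) * (t + h) by ring,
    show Real.pi * (k : ℕ) * (t / (1 + h) + h / (1 + h))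
      = Real.pi * (k : ℕ) / (1 + h) * (t + h) by ring]
  have h2 : (1 + h) * (2 / (1 + h)) = 2 := by field_simp
  generalize Real.cos _ = A
  generalize Real.cos _ = B
  linear_combination (1 + h) * A * B * hs + A * B * h2

/-- The coefficient of `differenceQuotient ν h` along `shiftedCosine h k`, for `h ≠ 0`. -/
noncomputable def cosineCoefficient (ν : TaperSpace) (k : ℕ+) (h : ℝ) : ℝ :=
  √(2 / (1 + h)) * (Real.pi * (k : ℕ) / (1 + h)) *
    (∫ t, zeroExtension ν t * (Real.sinc (Real.pi * (k : ℕ) / (1 + h) * h / 2)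
      * Real.sin (Real.pi * (k : ℕ) / (1 + h) * (t + h / 2))))

/-- Discrete integration by parts: the quotient vanishes off `[-h,1]`, so the integral runs over `ℝ`
and the shift passes to the cosine. Then `cos θt - cos θ(t+h) = 2 sin(θh/2) sin(θ(t+h/2))`. -/
theorem integral_differenceQuotient_mul_shiftedCosine (ν : TaperSpace) {h : ℝ} (hh : 0 < h)
    (k : ℕ+) :
    ∫ t in Set.Ioc (-h) 1, differenceQuotient ν h t * shiftedCosine h k t
      = cosineCoefficient ν k h := by
  have hsupp : ∀ t, t ∉ Set.Icc (-h) 1 → differenceQuotient ν h t * shiftedCosine h k t = 0 := by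
    intro t ht
    have h1 : t ∉ Set.Icc (0 : ℝ) 1 := fun h' => ht ⟨by linarith [h'.1], h'.2⟩
    have h2 : t + h ∉ Set.Icc (0 : ℝ) 1 := fun h' => ht ⟨by linarith [h'.1], by linarith [h'.2]⟩
    simp [differenceQuotient, zeroExtension_of_notMem ν h1, zeroExtension_of_notMem ν h2]
  rw [← integral_Icc_eq_integral_Ioc, setIntegral_eq_integral_of_forall_compl_eq_zero hsupp]
  have hint : ∀ g : ℝ → ℝ, Integrable g → Integrable fun t => g t * shiftedCosine h k t :=
    fun g hg => hg.mul_bdd (c := √(2 / (1 + h)))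
      (continuous_shiftedCosine h k).aestronglyMeasurable
      (Filter.Eventually.of_forall fun t => abs_shiftedCosine_le h k t)
  have hu := integrable_zeroExtension ν
  have e1 : ∫ t, zeroExtension ν (t + h) * shiftedCosine h k t
      = ∫ t, zeroExtension ν t * shiftedCosine h k (t - h) := by
    rw [← integral_add_right_eq_self
      (fun t => zeroExtension ν t * shiftedCosine h k (t - h)) h]
    simp
  have hi2 : Integrable fun t => zeroExtension ν t * shiftedCosine h k (t - h) := by
    simpa using (hint _ (hu.comp_add_right h)).comp_sub_right h
  calc ∫ t, differenceQuotient ν h t * shiftedCosine h k t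
      = h⁻¹ * (∫ t, (zeroExtension ν (t + h) * shiftedCosine h k t
          - zeroExtension ν t * shiftedCosine h k t)) := by
        rw [← integral_const_mul]
        congr 1; ext t
        rw [differenceQuotient]; ring
    _ = ∫ t, h⁻¹ * (zeroExtension ν t * shiftedCosine h k (t - h)
          - zeroExtension ν t * shiftedCosine h k t) := by
        rw [integral_sub (hint _ (hu.comp_add_right h)) (hint _ hu), e1, ← integral_sub hi2 (hint _ hu),
          integral_const_mul]
    _ = cosineCoefficient ν k h := by
        rw [cosineCoefficient, ← integral_const_mul]
        congr 1; ext t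
        set θ := Real.pi * (k : ℕ) / (1 + h) with hθ
        have hθ0 : θ ≠ 0 := by have := Real.pi_pos; have := k.pos; positivity
        have hne : θ * h / 2 ≠ 0 := by positivity
        rw [Real.sinc_of_ne_zero hne]
        simp only [shiftedCosine, ← hθ]
        have e3 := Real.cos_sub_cos (θ * (t - h + h)) (θ * (t + h))
        rw [show (θ * (t - h + h) + θ * (t + h)) / 2 = θ * (t + h / 2) by ring,
          show (θ * (t - h + h) - θ * (t + h)) / 2 = -(θ * h / 2) by ring, Real.sin_neg] at e3
        have e4 : θ * (Real.sin (θ * h / 2) / (θ * h / 2)) = h⁻¹ * (2 * Real.sin (θ * h / 2)) := by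
          field_simp
        linear_combination h⁻¹ * zeroExtension ν t * √(2 / (1 + h)) * e3
          - zeroExtension ν t * √(2 / (1 + h)) * Real.sin (θ * (t + h / 2)) * e4

/-- Writing the factor with `Real.sinc` removes the singularity at `h = 0`; the integrand is then
dominated by `|u|`, where `u` is the zero extension. -/
theorem continuousAt_cosineCoefficient (ν : TaperSpace) (k : ℕ+) :
    ContinuousAt (cosineCoefficient ν k) 0 := by
  unfold cosineCoefficient
  have hθ : ContinuousAt (fun h : ℝ => Real.pi * (k : ℕ) / (1 + h)) 0 :=
    continuousAt_const.div (by fun_prop) (by norm_num)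
  refine ContinuousAt.mul (ContinuousAt.mul ?_ hθ) ?_
  · exact Real.continuous_sqrt.continuousAt.comp (continuousAt_const.div (by fun_prop) (by norm_num))
  · refine continuousAt_of_dominated (bound := fun t => ‖zeroExtension ν t‖)
      (Filter.Eventually.of_forall fun h => ?_) (Filter.Eventually.of_forall fun h =>
      Filter.Eventually.of_forall fun t => ?_) (integrable_zeroExtension ν).norm
      (Filter.Eventually.of_forall fun t => ?_)
    · exact (integrable_zeroExtension ν).aestronglyMeasurable.mul
        (Continuous.aestronglyMeasurable (by fun_prop))
    · rw [norm_mul]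
      refine mul_le_of_le_one_right (norm_nonneg _) ?_
      rw [norm_mul, Real.norm_eq_abs, Real.norm_eq_abs]
      exact mul_le_one₀ (Real.abs_sinc_le_one _) (abs_nonneg _) (Real.abs_sin_le_one _)
    · refine continuousAt_const.mul (ContinuousAt.mul ?_ ?_)
      · exact Real.continuous_sinc.continuousAt.comp ((hθ.mul continuousAt_id).div_const 2)
      · exact Real.continuous_sin.continuousAt.comp (hθ.mul (by fun_prop))

theorem cosineCoefficient_zero (ν : TaperSpace) (k : ℕ+) :
    cosineCoefficient ν k 0 = Real.pi * (k : ℕ) * inner ℝ (sineTaper k) ν := by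
  rw [inner_sineTaper_eq_integral_zeroExtension, cosineCoefficient]
  simp only [add_zero, div_one, mul_zero, zero_div, Real.sinc_zero, one_mul]
  simp_rw [mul_left_comm _ (√2)]
  rw [integral_const_mul]
  ring

theorem ofReal_sum_sq_cosineCoefficient_le (ν : TaperSpace) {h : ℝ} (hh : 0 < h) (s : Finset ℕ+) :
    ENNReal.ofReal (∑ k ∈ s, cosineCoefficient ν k h ^ 2)
      ≤ ENNReal.ofReal (4 * Real.pi ^ 2) * localBias ν := by
  refine le_trans ?_ (lintegral_sq_differenceQuotient_le ν hh)
  have hD := memLp_differenceQuotient ν h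
  have hB := sum_sq_integral_mul_le (μ := volume.restrict (Set.Ioc (-h) 1)) (ψ := shiftedCosine h)
    (fun k => MemLp.of_bound (continuous_shiftedCosine h k).aestronglyMeasurable _
      (Filter.Eventually.of_forall fun t => abs_shiftedCosine_le h k t))
    (fun j k => integral_shiftedCosine_mul hh j k) (hD.restrict _) s
  simp only [integral_differenceQuotient_mul_shiftedCosine ν hh] at hB
  refine (ENNReal.ofReal_le_ofReal hB).trans ?_
  rw [ofReal_integral_eq_lintegral_ofReal
    ((memLp_two_iff_integrable_sq hD.1.restrict).1 (hD.restrict _))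
    (Filter.Eventually.of_forall fun t => sq_nonneg _)]
  refine (setLIntegral_le_lintegral _ _).trans (lintegral_mono fun t => ?_)
  rw [← ofReal_norm, ← ENNReal.ofReal_pow (norm_nonneg _), Real.norm_eq_abs, sq_abs]

/-- The local bias dominates the diagonal quadratic form with eigenvalues `k² / 4` in the sine
basis. -/
theorem ofReal_sum_sq_inner_sineTaper_le_localBias (ν : TaperSpace) (s : Finset ℕ+) :
    ENNReal.ofReal (∑ k ∈ s, ((k : ℕ) : ℝ) ^ 2 / 4 * inner ℝ (sineTaper k) ν ^ 2)
      ≤ localBias ν := by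
  have hc : ContinuousAt (fun h => ENNReal.ofReal (∑ k ∈ s, cosineCoefficient ν k h ^ 2)) 0 :=
    ENNReal.continuous_ofReal.continuousAt.comp
      (tendsto_finsetSum s fun k _ => (continuousAt_cosineCoefficient ν k).pow 2)
  -- The sum is finite and the upper bound does not depend on `h`, so `h → 0+` is harmless even when
  -- the bias is infinite.
  have hlim := le_of_tendsto (hc.tendsto.mono_left (nhdsWithin_le_nhds (s := Set.Ioi 0)))
    (Filter.eventually_of_mem self_mem_nhdsWithin fun h hh =>
      ofReal_sum_sq_cosineCoefficient_le ν hh s)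
  have hpi := Real.pi_pos
  have e : ∑ k ∈ s, cosineCoefficient ν k 0 ^ 2
      = 4 * Real.pi ^ 2 * ∑ k ∈ s, ((k : ℕ) : ℝ) ^ 2 / 4 * inner ℝ (sineTaper k) ν ^ 2 := by
    rw [Finset.mul_sum]
    refine Finset.sum_congr rfl fun k _ => ?_
    rw [cosineCoefficient_zero]
    ring
  rw [e, ENNReal.ofReal_mul (by positivity)] at hlim
  exact (ENNReal.mul_le_mul_iff_right (by simp) ENNReal.ofReal_ne_top).1 hlim

/-! ### The exact local bias of the sines. -/

/-- The function `√2 cos(π k t)` on `[0,1]`, extended by zero. -/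
noncomputable def truncatedCosine (k : ℕ+) : ℝ → ℂ :=
  (Set.Icc (0 : ℝ) 1).indicator fun t => ((√2 * Real.cos (Real.pi * (k : ℕ) * t) : ℝ) : ℂ)

theorem memLp_truncatedCosine (k : ℕ+) (p : ENNReal) : MemLp (truncatedCosine k) p := by
  refine (memLp_indicator_iff_restrict measurableSet_Icc).2 ?_
  refine MemLp.of_bound (Continuous.aestronglyMeasurable (by fun_prop)) (√2)
    (Filter.Eventually.of_forall fun t => ?_)
  rw [Complex.norm_real, Real.norm_eq_abs, abs_mul, abs_of_nonneg (Real.sqrt_nonneg _)]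
  exact mul_le_of_le_one_right (Real.sqrt_nonneg _) (Real.abs_cos_le_one _)

theorem lintegral_sq_truncatedCosine (k : ℕ+) : ∫⁻ t, ‖truncatedCosine k t‖ₑ ^ 2 = 1 := by
  have e : ∀ t, ‖truncatedCosine k t‖ₑ ^ 2 = (Set.Icc (0 : ℝ) 1).indicator (fun t =>
      ENNReal.ofReal (2 * (Real.cos (Real.pi * (k : ℕ) * t) * Real.cos (Real.pi * (k : ℕ) * t)))) t := by
    intro t
    by_cases ht : t ∈ Set.Icc (0 : ℝ) 1
    · rw [truncatedCosine, Set.indicator_of_mem ht, Set.indicator_of_mem ht, ← ofReal_norm,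
        ← ENNReal.ofReal_pow (norm_nonneg _), Complex.norm_real, Real.norm_eq_abs, sq_abs, mul_pow,
        Real.sq_sqrt (by norm_num), sq (Real.cos _)]
    · simp [truncatedCosine, ht]
  simp_rw [e]
  rw [lintegral_indicator measurableSet_Icc, ← ofReal_integral_eq_lintegral_ofReal
    (ContinuousOn.integrableOn_Icc (by fun_prop))
    (Filter.Eventually.of_forall fun t => mul_nonneg zero_le_two (mul_self_nonneg _)),
    integral_Icc_eq_integral_Ioc, ← intervalIntegral.integral_of_le zero_le_one,
    integral_two_mul_cos_mul_cos]
  simp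

/-- Integration by parts, with no boundary terms because `sin(πkt)` vanishes at `0` and `1`. -/
theorem pi_mul_fourier_truncatedCosine (k : ℕ+) (f : ℝ) :
    (Real.pi * (k : ℕ)) * 𝓕 (truncatedCosine k) f
      = 2 * Real.pi * Complex.I * f * spectralWindow (sineTaper k) f := by
  set e : ℝ → ℂ := fun t => Complex.exp (-(2 * Real.pi * Complex.I * f * t)) with he
  have hV : spectralWindow (sineTaper k) f
      = ∫ t in (0 : ℝ)..1, √2 * Complex.sin (Real.pi * (k : ℕ) * t) * e t := by
    rw [intervalIntegral.integral_of_le zero_le_one, ← integral_Icc_eq_integral_Ioc, spectralWindow]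
    refine integral_congr_ae ?_
    filter_upwards [(memLp_sine k).coeFn_toLp] with t ht
    rw [sineTaper, ht]
    push_cast
    rfl
  have hC : 𝓕 (truncatedCosine k) f
      = ∫ t in (0 : ℝ)..1, √2 * Complex.cos (Real.pi * (k : ℕ) * t) * e t := by
    rw [intervalIntegral.integral_of_le zero_le_one, ← integral_Icc_eq_integral_Ioc,
      Real.fourier_eq', ← integral_indicator measurableSet_Icc]
    congr 1
    ext t
    by_cases ht : t ∈ Set.Icc (0 : ℝ) 1
    · simp only [ht, Set.indicator_of_mem, truncatedCosine, smul_eq_mul]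
      rw [mul_comm]
      push_cast
      congr 2
      simp
      ring
    · simp [truncatedCosine, ht]
  have hderiv : ∀ t ∈ Set.uIcc (0 : ℝ) 1, HasDerivAt
      (fun t : ℝ => √2 * Complex.sin (Real.pi * (k : ℕ) * t) * e t)
      ((Real.pi * (k : ℕ)) * (√2 * Complex.cos (Real.pi * (k : ℕ) * t) * e t)
        - 2 * Real.pi * Complex.I * f * (√2 * Complex.sin (Real.pi * (k : ℕ) * t) * e t)) t := by
    intro t _
    have h0 : HasDerivAt (fun t : ℝ => (t : ℂ)) 1 t := Complex.ofRealCLM.hasDerivAt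
    have hsin : HasDerivAt (fun t : ℝ => √2 * Complex.sin (Real.pi * (k : ℕ) * t))
        (√2 * (Complex.cos (Real.pi * (k : ℕ) * t) * (Real.pi * (k : ℕ) * 1))) t :=
      ((Complex.hasDerivAt_sin _).comp t (h0.const_mul ((Real.pi : ℂ) * (k : ℕ)))).const_mul (√2 : ℂ)
    have hexp : HasDerivAt e (e t * -(2 * Real.pi * Complex.I * f * 1)) t :=
      (Complex.hasDerivAt_exp _).comp t (h0.const_mul (2 * Real.pi * Complex.I * f)).neg
    refine (hsin.mul hexp).congr_deriv ?_
    simp only [he]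
    ring
  have hint := intervalIntegral.integral_eq_sub_of_hasDerivAt hderiv
    (by apply Continuous.intervalIntegrable; fun_prop)
  rw [intervalIntegral.integral_sub (by apply Continuous.intervalIntegrable; fun_prop)
    (by apply Continuous.intervalIntegrable; fun_prop), intervalIntegral.integral_const_mul,
    intervalIntegral.integral_const_mul, ← hV, ← hC] at hint
  have hs : Complex.sin (Real.pi * (k : ℕ)) = 0 := by
    rw [mul_comm]; exact Complex.sin_nat_mul_pi _
  simp only [Complex.ofReal_one, mul_one, hs, Complex.ofReal_zero, mul_zero, zero_mul,
    Complex.sin_zero, sub_zero] at hint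
  exact sub_eq_zero.1 hint

/-- The preceding identity makes the integrand `k²/4` times the squared transform of a function of
unit `L²` norm; Plancherel evaluates it. -/
theorem localBias_sineTaper (k : ℕ+) :
    localBias (sineTaper k) = ENNReal.ofReal (((k : ℕ) : ℝ) ^ 2 / 4) := by
  have hP := lintegral_enorm_sq_fourier (memLp_one_iff_integrable.1 (memLp_truncatedCosine k 1))
    (memLp_truncatedCosine k 2)
  rw [lintegral_sq_truncatedCosine] at hP
  rw [localBias, ← mul_one (ENNReal.ofReal (((k : ℕ) : ℝ) ^ 2 / 4)), ← hP,
    ← lintegral_const_mul' _ _ ENNReal.ofReal_ne_top]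
  congr 1
  ext f
  rw [← ofReal_norm, ← ENNReal.ofReal_pow (norm_nonneg _), ← ENNReal.ofReal_mul (by positivity)]
  congr 1
  have h := congrArg norm (pi_mul_fourier_truncatedCosine k f)
  simp only [norm_mul, Complex.norm_real, Complex.norm_I, Complex.norm_natCast, Real.norm_eq_abs,
    abs_of_pos Real.pi_pos, Complex.norm_ofNat, mul_one] at h
  have h' : ((k : ℕ) : ℝ) * ‖𝓕 (truncatedCosine k) f‖
      = 2 * |f| * ‖spectralWindow (sineTaper k) f‖ :=
    mul_left_cancel₀ Real.pi_ne_zero (by linear_combination h)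
  rw [← sq_abs f]
  linear_combination (-(1 : ℝ) / 4) * ((k : ℕ) * ‖𝓕 (truncatedCosine k) f‖
      + 2 * |f| * ‖spectralWindow (sineTaper k) f‖) * h'

theorem localBias_neg (ν : TaperSpace) : localBias (-ν) = localBias ν := by
  have h : ∀ f, spectralWindow (-ν) f = -spectralWindow ν f := fun f => by
    rw [spectralWindow, spectralWindow, ← integral_neg]
    refine integral_congr_ae ?_
    filter_upwards [Lp.coeFn_neg ν] with t ht
    rw [ht]
    simp
  simp [localBias, h]

/-! ### Extremality, rigidity and induction. -/

/-- The spectral gap estimate for the local bias on the orthogonal complement of the first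
`k - 1` sine tapers. -/
theorem ofReal_le_localBias_of_orthogonal {w : TaperSpace} {k : ℕ+} (hw : ‖w‖ = 1)
    (ho : ∀ j < k, inner ℝ (sineTaper j) w = 0) (m : ℕ+) :
    ENNReal.ofReal (((k : ℕ) : ℝ) ^ 2 / 4
      + (((m : ℕ) : ℝ) ^ 2 - ((k : ℕ) : ℝ) ^ 2) / 4 * inner ℝ (sineTaper m) w ^ 2)
      ≤ localBias w := by
  set c : ℕ+ → ℝ := fun j => inner ℝ (sineTaper j) w with hc
  have hsum : HasSum (fun j => c j ^ 2) 1 := by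
    simpa [hw] using hasSum_sq_inner_sineTaper w
  have hlim : Filter.Tendsto (fun s : Finset ℕ+ => ENNReal.ofReal
      (((k : ℕ) : ℝ) ^ 2 / 4 * ∑ j ∈ s, c j ^ 2
        + (((m : ℕ) : ℝ) ^ 2 - ((k : ℕ) : ℝ) ^ 2) / 4 * c m ^ 2)) Filter.atTop
      (nhds (ENNReal.ofReal (((k : ℕ) : ℝ) ^ 2 / 4 * 1
        + (((m : ℕ) : ℝ) ^ 2 - ((k : ℕ) : ℝ) ^ 2) / 4 * c m ^ 2))) :=
    ENNReal.tendsto_ofReal ((hsum.const_mul _).add_const _)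
  rw [mul_one] at hlim
  refine le_of_tendsto hlim ((Filter.eventually_ge_atTop {m}).mono fun s hs => ?_)
  refine le_trans (ENNReal.ofReal_le_ofReal ?_) (ofReal_sum_sq_inner_sineTaper_le_localBias w s)
  have hm : m ∈ s := hs (Finset.mem_singleton_self m)
  -- The `m`-th term keeps its exact weight `m²/4`; every other weight is lowered to `k²/4`. Taking
  -- `m = k` gives the minimum, `m > k` the rigidity.
  rw [← Finset.add_sum_erase s _ hm, ← Finset.add_sum_erase s (fun j => _ * _) hm,
    mul_add, Finset.mul_sum]
  have hle : ∑ j ∈ s.erase m, ((k : ℕ) : ℝ) ^ 2 / 4 * c j ^ 2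
      ≤ ∑ j ∈ s.erase m, ((j : ℕ) : ℝ) ^ 2 / 4 * c j ^ 2 := by
    refine Finset.sum_le_sum fun j _ => ?_
    rcases lt_or_ge j k with hj | hj
    · simp [hc, ho j hj]
    · have : ((k : ℕ) : ℝ) ≤ (j : ℕ) := by exact_mod_cast hj
      gcongr
  have hcm : c m = inner ℝ (sineTaper m) w := rfl
  rw [← hcm]
  linarith

/-- Each `m > k` with a nonzero coefficient would add a strictly positive excess over `k²/4`, so
only the `k`-th coefficient survives, and the norm makes it `±1`. -/
theorem eq_sineTaper_or_neg_of_localBias_le {w : TaperSpace} {k : ℕ+} (hw : ‖w‖ = 1)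
    (ho : ∀ j < k, inner ℝ (sineTaper j) w = 0)
    (hB : localBias w ≤ ENNReal.ofReal (((k : ℕ) : ℝ) ^ 2 / 4)) :
    w = sineTaper k ∨ w = -sineTaper k := by
  have hne : ∀ m, m ≠ k → inner ℝ (sineTaper m) w = 0 := by
    intro m hm
    rcases lt_or_gt_of_ne hm with hlt | hgt
    · exact ho m hlt
    · have h := (ENNReal.ofReal_le_ofReal_iff (by positivity)).1
        ((ofReal_le_localBias_of_orthogonal hw ho m).trans hB)
      have hkm : ((k : ℕ) : ℝ) < (m : ℕ) := by exact_mod_cast hgt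
      have hpos : 0 < (((m : ℕ) : ℝ) ^ 2 - ((k : ℕ) : ℝ) ^ 2) / 4 := by
        have : ((k : ℕ) : ℝ) ^ 2 < ((m : ℕ) : ℝ) ^ 2 := by gcongr
        linarith
      have h0 : inner ℝ (sineTaper m) w ^ 2 ≤ 0 := by
        by_contra hcon
        have := mul_pos hpos (not_le.1 hcon)
        linarith
      exact pow_eq_zero_iff (two_ne_zero) |>.1 (le_antisymm h0 (sq_nonneg _))
  have hself : inner ℝ (sineTaper k) (sineTaper k) = 1 := by
    rw [real_inner_self_eq_norm_sq, orthonormal_sineTaper.norm_eq_one, one_pow]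
  have hexp : w = inner ℝ (sineTaper k) w • sineTaper k := by
    rw [← sub_eq_zero]
    refine eq_zero_of_inner_sineTaper_eq_zero fun j => ?_
    rw [inner_sub_right, inner_smul_right]
    rcases eq_or_ne j k with rfl | hj
    · rw [hself]; ring
    · rw [hne j hj, orthonormal_sineTaper.inner_eq_zero hj]; ring
  have habs : |inner ℝ (sineTaper k) w| = 1 := by
    have := congrArg norm hexp
    rwa [norm_smul, orthonormal_sineTaper.norm_eq_one, mul_one, hw, Real.norm_eq_abs, eq_comm] at this
  rcases eq_or_eq_neg_of_abs_eq habs with h | h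
  · left; rw [h, one_smul] at hexp; exact hexp
  · right; rw [h, neg_one_smul] at hexp; exact hexp

theorem localBias_of_eq_or_neg {w : TaperSpace} {k : ℕ+}
    (h : w = sineTaper k ∨ w = -sineTaper k) :
    localBias w = ENNReal.ofReal (((k : ℕ) : ℝ) ^ 2 / 4) := by
  rcases h with rfl | rfl
  · exact localBias_sineTaper k
  · rw [localBias_neg, localBias_sineTaper]

theorem mem_admissibleTapers_iff {v : ℕ+ → TaperSpace} {k : ℕ+}
    (h : ∀ j < k, v j = sineTaper j ∨ v j = -sineTaper j) {w : TaperSpace} :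
    w ∈ admissibleTapers v k ↔ ‖w‖ = 1 ∧ ∀ j < k, inner ℝ (sineTaper j) w = 0 := by
  refine and_congr_right fun _ => forall₂_congr fun j hj => ?_
  rcases h j hj with e | e <;> simp [e]

/-- Once the earlier tapers are sines up to sign, the sine of index `k` is itself a competitor, so
the bias of `v k` is at most `k²/4` and rigidity applies. -/
theorem eq_or_neg_of_isMinimumBiasSystem {v : ℕ+ → TaperSpace} (hv : IsMinimumBiasSystem v)
    (k : ℕ+) : v k = sineTaper k ∨ v k = -sineTaper k := by
  induction k using PNat.strongInductionOn with
  | _ k ih =>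
    obtain ⟨hmem, hmin⟩ := hv k
    rw [mem_admissibleTapers_iff ih] at hmem
    have hs : sineTaper k ∈ admissibleTapers v k := (mem_admissibleTapers_iff ih).2
      ⟨orthonormal_sineTaper.norm_eq_one k, fun j hj => orthonormal_sineTaper.inner_eq_zero hj.ne⟩
    exact eq_sineTaper_or_neg_of_localBias_le hmem.1 hmem.2
      ((hmin hs).trans_eq (localBias_sineTaper k))

theorem isMinimumBiasSystem_of_eq_or_neg {v : ℕ+ → TaperSpace}
    (h : ∀ k, v k = sineTaper k ∨ v k = -sineTaper k) : IsMinimumBiasSystem v := by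
  intro k
  have hadm := fun w => mem_admissibleTapers_iff (k := k) (w := w) fun j _ => h j
  refine ⟨(hadm _).2 ⟨?_, fun j hj => ?_⟩, fun w hw => ?_⟩
  · rcases h k with e | e <;> simp [e, orthonormal_sineTaper.norm_eq_one]
  · rcases h k with e | e <;> simp [e, orthonormal_sineTaper.inner_eq_zero hj.ne]
  · obtain ⟨hw1, hw2⟩ := (hadm w).1 hw
    have := ofReal_le_localBias_of_orthogonal hw1 hw2 k
    rw [sub_self, zero_div, zero_mul, add_zero] at this
    exact (localBias_of_eq_or_neg (h k)).trans_le this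

theorem theorem1 :
    (∀ v : ℕ+ → TaperSpace,
      IsMinimumBiasSystem v ↔ ∀ k : ℕ+, v k = sineTaper k ∨ v k = -sineTaper k) ∧
    (∀ v : ℕ+ → TaperSpace, IsMinimumBiasSystem v →
      ∀ k : ℕ+, localBias (v k) = ENNReal.ofReal (((k : ℕ) : ℝ) ^ 2 / 4)) :=
  ⟨fun _ => ⟨eq_or_neg_of_isMinimumBiasSystem, isMinimumBiasSystem_of_eq_or_neg⟩,
    fun _ hv k => localBias_of_eq_or_neg (eq_or_neg_of_isMinimumBiasSystem hv k)⟩
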